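/- Let $\lambda>0$, let $P(z)=z^n+a_1z^{n-1}+\dots+a_n\in\mathbb C[z]$ be a monic polynomial of degree $n\ge 1$ with roots $\alpha_1,\dots,\alpha_n$ (repeated according to multiplicity). For $m\ge 1$ let $S_m=\sum_{j=1}^n\alpha_j^m$, let $\Sigma_j$ be the $j$-th elementary symmetric function of the roots, and put $$f(s)=e^{-\lambda n s}P(e^{\lambda s})=1+a_1e^{-\lambda s}+\dots+a_ne^{-n\lambda s}.$$ For $\mathbf k=(k_1,\dots,k_n)\in\mathbb N^n\setminus\{0\}$ write $\|\mathbf k\|=\sum_j k_j$, $\langle\boldsymbol\lambda,\mathbf k\rangle=\lambda(k_1+2k_2+\dots+nk_n)$ and $$b_{\mathbf k}=\frac{(-1)^{\|\mathbf k\|}}{\|\mathbf k\|}\,\frac{\|\mathbf k\|!}{\prod_j k_j!}\,\prod_j a_j^{k_j}.$$ For a meromorphic function $f$ on $\mathbb C$ with multiplicities $n_\rho$ (positive at zeros, negative at poles, $0$ elsewhere), let $d$ be the least integer $d\ge 0$ with $\sum_{\rho\ne0}|n_\rho||\rho|^{-d}<\infty$. For $\sigma\in\mathbb C$ let $$K_{d,\sigma}(t)=n_\sigma\frac{t^d}{d!}+\sum_{\rho\ne\sigma}\frac{n_\rho}{(\rho-\sigma)^d}e^{(\rho-\sigma)t}\quad(t\ge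 0),\qquad W_\sigma(f)=e^{\sigma t}\frac{D^d}{Dt^d}\Big((K_{d,\sigma}(t)-K_{d,\sigma}(0))\mathbf 1_{\mathbb R_+}\Big),$$ with $D/Dt$ the distributional derivative. Then, for the function $f$ defined from $P$ above: 1. The $b_{\mathbf k}$ are the coefficients of $-\log f$: for all $s$ with $\Re s$ sufficiently large, $-\log f(s)=\sum_{\mathbf k\ne0}b_{\mathbf k}e^{-\langle\boldsymbol\lambda,\mathbf k\rangle s}$ (principal branch, absolutely convergent). 2. There is a distribution $W(f)$ on $\mathbb R_+^*=\,]0,\infty[$ which is the restriction of $W_\sigma(f)$ to $\mathbb R_+^*$ for every $\sigma\in\mathbb C$. Moreover $W(f)=\sum_\rho n_\rho e^{\rho t}$ (weak limit over the finite sets of $\rho$) and $W(f)=\lambda\sum_{m\ge1}S_m\,\delta_{m\lambda}$ on $\mathbb R_+^*$. 3. For every family $(c_{\mathbf k})_{\mathbf k\in\mathbb N^n\setminus\{0\}}$ of complex numbers, the formula $W(f)=\sum_{\mathbf k\ne0}\langle\boldsymbol\lambda,\mathbf k\rangle\,c_{\mathbf k}\,\delta_{\langle\boldsymbol\lambda,\mathbf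 k\rangle}$ (as distributions on $\mathbb R_+^*$) holds if and only if $$S_m=m\sum_{k_1+2k_2+\dots+nk_n=m}c_{\mathbf k}\qquad\text{for all } m\ge1 .$$ In particular (taking $c_{\mathbf k}=b_{\mathbf k}$) the Poisson–Newton formula on $\mathbb R_+^*$ for $f$ is equivalent to Newton's relations for $P$. 4. Both hold for $c_{\mathbf k}=b_{\mathbf k}$: the Poisson–Newton formula $W(f)=\sum_{\mathbf k\ne0}\langle\boldsymbol\lambda,\mathbf k\rangle\,b_{\mathbf k}\,\delta_{\langle\boldsymbol\lambda,\mathbf k\rangle}$ holds on $\mathbb R_+^*$, and for all $m\ge1$ $$S_m=m\sum_{k_1+2k_2+\dots+nk_n=m}b_{\mathbf k}=m\sum_{k_1+2k_2+\dots+nk_n=m}(-1)^{m+\|\mathbf k\|}\,\frac{(\|\mathbf k\|-1)!}{\prod_jk_j!}\,\prod_j\Sigma_j^{k_j}.$$ -/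

import Mathlib

open scoped Distributions

noncomputable section

namespace PoissonNewton

/-- The open half line of positive reals. -/
def posReals : TopologicalSpace.Opens ℝ := ⟨Set.Ioi 0, isOpen_Ioi⟩

/-! ### The divisor and the Newton-Cramer distribution of a meromorphic function -/

/-- The multiplicity of `f` at `ρ`: positive at zeros, negative at poles, `0` elsewhere. -/
def mult (f : ℂ → ℂ) (ρ : ℂ) : ℤ := MeromorphicOn.divisor f Set.univ ρ

/-- The convergence exponent of `f`: the least integer `d ≥ 0` with
`∑_{ρ ≠ 0} |n_ρ| |ρ|^{-d} < ∞`. -/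
def convExponent (f : ℂ → ℂ) : ℕ :=
  sInf {d : ℕ | Summable fun ρ : {ρ : ℂ // ρ ≠ 0} =>
    |(mult f ρ.1 : ℝ)| * ‖ρ.1‖ ^ (-(d : ℤ))}

/-- The function `K_{d,σ}(t) = n_σ t^d / d! + ∑_{ρ ≠ σ} n_ρ (ρ - σ)^{-d} e^{(ρ - σ) t}`
(used for `t ≥ 0`), where `d` is the convergence exponent. -/
def kernelK (f : ℂ → ℂ) (σ : ℂ) (t : ℝ) : ℂ :=
  (mult f σ : ℂ) * ((t : ℂ) ^ convExponent f / (Nat.factorial (convExponent f) : ℂ)) +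
    ∑' ρ : {ρ : ℂ // ρ ≠ σ},
      (mult f ρ.1 : ℂ) / (ρ.1 - σ) ^ convExponent f * Complex.exp ((ρ.1 - σ) * (t : ℂ))

/-- The Newton-Cramer distribution
`W_σ(f) = e^{σ t} (D/Dt)^d ((K_{d,σ}(t) - K_{d,σ}(0)) 1_{t ≥ 0})`, paired with `φ`:
the distributional derivatives and the factor `e^{σ t}` are moved to the test function. -/
def newtonCramer (f : ℂ → ℂ) (σ : ℂ) (φ : ℝ → ℂ) : ℂ :=
  (-1) ^ convExponent f * ∫ t in Set.Ioi (0 : ℝ), (kernelK f σ t - kernelK f σ 0) *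
    iteratedDeriv (convExponent f) (fun u : ℝ => Complex.exp (σ * (u : ℂ)) * φ u) t

/-- The distribution `W` on the positive half line is `W(f)`: it is the restriction of `W_σ(f)`,
for every `σ`, and it is the sum `∑_ρ n_ρ e^{ρ t}`, over the filter of finite sets of `ρ`. -/
structure IsNewtonCramer (f : ℂ → ℂ) (W : 𝓓'(posReals, ℂ)) : Prop where
  restrict : ∀ (σ : ℂ) (φ : 𝓓(posReals, ℝ)), W φ = newtonCramer f σ (fun t => (φ t : ℂ))
  hasSum : ∀ φ : 𝓓(posReals, ℝ),
    HasSum (fun ρ : ℂ => (mult f ρ : ℂ) * ∫ t : ℝ, Complex.exp (ρ * (t : ℂ)) * (φ t : ℂ)) (W φ)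

/-! ### Finite Dirichlet series -/

section Dirichlet

variable {ι : Type*} [Fintype ι]

/-- The finite Dirichlet series `1 + ∑_j a_j e^{-λ_j s}`. -/
def dirichlet (a : ι → ℂ) (freq : ι → ℝ) (s : ℂ) : ℂ :=
  1 + ∑ j, a j * Complex.exp (-(freq j : ℂ) * s)

/-- The pairing `⟨λ, k⟩ = ∑_j λ_j k_j`. -/
def pairing (freq : ι → ℝ) (k : ι → ℕ) : ℝ := ∑ j, freq j * (k j : ℝ)

/-- The coefficient `b_k = ((-1)^‖k‖ / ‖k‖) (‖k‖! / ∏ k_j!) ∏ a_j^{k_j}`, where `‖k‖ = ∑ k_j`.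
Only used for `k ≠ 0`. -/
def logCoeff (a : ι → ℂ) (k : ι → ℕ) : ℂ :=
  ((-1) ^ (∑ j, k j) / ((∑ j, k j : ℕ) : ℂ)) *
    ((Nat.factorial (∑ j, k j) : ℂ) / ((∏ j, Nat.factorial (k j) : ℕ) : ℂ)) * ∏ j, a j ^ k j

/-- The Poisson-Newton formula `W = ∑_{k ≠ 0} ⟨λ, k⟩ b_k δ_{⟨λ, k⟩}` between distributions on the
positive half line. -/
def Formula (freq : ι → ℝ) (b : (ι → ℕ) → ℂ) (W : 𝓓'(posReals, ℂ)) : Prop :=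
  ∀ φ : 𝓓(posReals, ℝ),
    HasSum (fun k : {k : ι → ℕ // k ≠ 0} =>
      (pairing freq k.1 : ℂ) * b k.1 * (φ (pairing freq k.1) : ℂ)) (W φ)

end Dirichlet

/-! ### Newton sums -/

/-- The coefficients of `P = z^n + a_1 z^{n-1} + ⋯ + a_n`; the index `j : Fin n` stands for the
subscript `j + 1`. -/
def polyCoeff (n : ℕ) (P : Polynomial ℂ) (j : Fin n) : ℂ := P.coeff (n - (j.val + 1))

/-- The frequencies `λ, 2λ, …, nλ`. -/
def multiples (n : ℕ) (lam : ℝ) (j : Fin n) : ℝ := ((j.val + 1 : ℕ) : ℝ) * lam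

/-- The Newton sum `S_m = ∑ α_j^m` over the roots of `P` with multiplicity. -/
def newtonSum (P : Polynomial ℂ) (m : ℕ) : ℂ := (P.roots.map fun α => α ^ m).sum

/-- The finite set of `k ∈ ℕ^n` with `k_1 + 2 k_2 + ⋯ + n k_n = m`. -/
def weighted (n m : ℕ) : Finset (Fin n → ℕ) :=
  (Fintype.piFinset fun _ => Finset.range (m + 1)).filter
    fun k => ∑ j, (j.val + 1) * k j = m

theorem mem_weighted {n m : ℕ} {k : Fin n → ℕ} :
    k ∈ weighted n m ↔ ∑ j, (j.val + 1) * k j = m := by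
  simp only [weighted, Finset.mem_filter, Fintype.mem_piFinset, Finset.mem_range,
    and_iff_right_iff_imp]
  intro h j
  have h1 : (j.val + 1) * k j ≤ ∑ i, (i.val + 1) * k i :=
    Finset.single_le_sum (f := fun i : Fin n => (i.val + 1) * k i)
      (fun _ _ => Nat.zero_le _) (Finset.mem_univ j)
  nlinarith

/-- Newton's relations for `P` with coefficients `b`:
`S_m = m ∑_{k_1 + 2 k_2 + ⋯ + n k_n = m} b_k` for all `m ≥ 1`. -/
def NewtonRelations (n : ℕ) (P : Polynomial ℂ) (b : (Fin n → ℕ) → ℂ) : Prop :=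
  ∀ m : ℕ, 1 ≤ m → newtonSum P m = (m : ℂ) * ∑ k ∈ weighted n m, b k

end PoissonNewton

end

open Filter Topology MeasureTheory

noncomputable section

namespace PoissonNewton

/-! ### Regrouping sums along finite fibres -/

section Fibers

variable {β : Type*} {E : Type*} [NormedAddCommGroup E] {p : β → ℕ} {S : ℕ → Finset β}

/-! Since `f(s) = e^{-λns} P(e^{λs})`, the zeros of `f` are the solutions `ρ` of `e^{λρ} = α` for
the nonzero roots `α`, counted with the multiplicity of `α`. For fixed `α` they are `(log α +
2πik)/λ`, and Poisson summation turns `∑_k e^{ρ_k t}` into `λ ∑_m α^m δ_{mλ}`; only `m ≥ 1` is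
visible on the open half line (`hasSum_integral_logBranch`). A zero root contributes nothing to
either side. Summing over the roots gives `W(f) = λ ∑ S_m δ_{mλ}`.

To identify this with each `W_σ(f)`, sum and integral are interchanged and every term is integrated
by parts `d` times; the constant `K(0)` disappears because `d ≥ 1` as soon as there is a zero
(`newtonCramer_eq_of_hasSum`).

A Poisson-Newton formula is then an equality of two combs on the multiples of `λ`. Grouping the `k`
by weight `k_1 + 2k_2 + ⋯ + nk_n` and testing near a single `mλ` compares coefficients, which are
Newton's relations (`formula_comb_iff`). For the `b_k` these relations come from expanding `-log ∏
(1 - αz)` at `0` in two ways: root by root, and through the multinomial theorem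
(`newtonRelations_logCoeff`). -/

theorem hasSum_fiber_finset (hS : ∀ N k, k ∈ S N ↔ p k = N) (f : β → E) (N : ℕ) :
    HasSum (fun c : {k // p k = N} => f c) (∑ k ∈ S N, f k) := by
  have e : {k | p k = N} = (S N : Set β) := by ext k; simp [hS]
  change HasSum (f ∘ (Subtype.val : {k | p k = N} → β)) _
  rw [e]
  exact (S N).hasSum f

theorem hasSum_regroup (hS : ∀ N k, k ∈ S N ↔ p k = N) {f : β → E} {a : E} (h : HasSum f a) :
    HasSum (fun N => ∑ k ∈ S N, f k) a :=
  HasSum.sigma ((Equiv.sigmaFiberEquiv p).hasSum_iff.mpr h) fun N => hasSum_fiber_finset hS f N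

theorem summable_of_summable_fiber_norm [CompleteSpace E] (hS : ∀ N k, k ∈ S N ↔ p k = N)
    {f : β → E} (h : Summable fun N => ∑ k ∈ S N, ‖f k‖) : Summable f := by
  refine Summable.of_norm ((Equiv.sigmaFiberEquiv p).summable_iff.mp ?_)
  refine (summable_sigma_of_nonneg fun _ => norm_nonneg _).mpr ⟨fun N => ?_, ?_⟩
  · exact (hasSum_fiber_finset hS (fun k => ‖f k‖) N).summable
  · refine h.congr fun N => ?_
    exact (hasSum_fiber_finset hS (fun k => ‖f k‖) N).tsum_eq.symm

end Fibers

/-! ### The logarithm of a finite Dirichlet series -/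

section Log

variable {ι : Type*} [Fintype ι]

theorem logCoeff_zero (a : ι → ℂ) : logCoeff a 0 = 0 := by simp [logCoeff]

theorem logCoeff_mul (a y : ι → ℂ) (k : ι → ℕ) :
    logCoeff (fun j => a j * y j) k = logCoeff a k * ∏ j, y j ^ k j := by
  simp only [logCoeff, mul_pow, Finset.prod_mul_distrib]
  ring

theorem logCoeff_eq_multinomial (a : ι → ℂ) (k : ι → ℕ) :
    logCoeff a k = (-1) ^ (∑ j, k j) / ((∑ j, k j : ℕ) : ℂ) *
      ((Nat.multinomial Finset.univ k : ℂ) * ∏ j, a j ^ k j) := by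
  rw [logCoeff, Nat.multinomial, Nat.cast_div (Nat.prod_factorial_dvd_factorial_sum _ _)
    (by exact_mod_cast (Finset.prod_pos fun i _ => Nat.factorial_pos _).ne'), mul_assoc]

/-- By the multinomial theorem, the terms of total degree `N` add up to the `N`-th term of the
series of `-log(1 + ∑ x_j)`. -/
theorem sum_piAntidiag_logCoeff [DecidableEq ι] (x : ι → ℂ) (N : ℕ) :
    ∑ k ∈ Finset.piAntidiag Finset.univ N, logCoeff x k = (-∑ j, x j) ^ N / N := by
  rw [neg_pow, Finset.sum_pow_eq_sum_piAntidiag, Finset.mul_sum, Finset.sum_div]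
  refine Finset.sum_congr rfl fun k hk => ?_
  rw [Finset.mem_piAntidiag] at hk
  rw [logCoeff_eq_multinomial, hk.1]
  ring

theorem sum_piAntidiag_norm_logCoeff [DecidableEq ι] (x : ι → ℂ) (N : ℕ) :
    ∑ k ∈ Finset.piAntidiag Finset.univ N, ‖logCoeff x k‖ = (∑ j, ‖x j‖) ^ N / N := by
  rw [Finset.sum_pow_eq_sum_piAntidiag, Finset.sum_div]
  refine Finset.sum_congr rfl fun k hk => ?_
  rw [Finset.mem_piAntidiag] at hk
  rw [logCoeff_eq_multinomial, hk.1]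
  simp only [norm_mul, norm_div, norm_pow, norm_neg, norm_one, one_pow, Complex.norm_natCast,
    norm_prod]
  ring

/-- The norms in degree `N` add up to `(∑ ‖x_j‖)^N / N`, so a geometric series gives absolute
convergence; grouping by degree then identifies the sum with the logarithmic series. -/
theorem hasSum_logCoeff {x : ι → ℂ} (hx : ∑ j, ‖x j‖ < 1) :
    HasSum (logCoeff x) (-Complex.log (1 + ∑ j, x j)) := by
  classical
  have hS : ∀ (N : ℕ) (k : ι → ℕ),
      k ∈ Finset.piAntidiag Finset.univ N ↔ ∑ j, k j = N := by
    intro N k; simp [Finset.mem_piAntidiag]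
  have h0 : 0 ≤ ∑ j, ‖x j‖ := Finset.sum_nonneg fun _ _ => norm_nonneg _
  have hs : Summable (logCoeff x) := by
    refine summable_of_summable_fiber_norm hS ?_
    simp only [sum_piAntidiag_norm_logCoeff]
    refine Summable.of_nonneg_of_le (fun N => by positivity) (fun N => ?_)
      (summable_geometric_of_lt_one h0 hx)
    rcases Nat.eq_zero_or_pos N with rfl | hN
    · simp
    · exact div_le_self (by positivity) (by exact_mod_cast hN)
  have h1 := hasSum_regroup hS hs.hasSum
  simp only [sum_piAntidiag_logCoeff] at h1
  have h2 : ‖-∑ j, x j‖ < 1 := by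
    rw [norm_neg]
    exact (norm_sum_le _ _).trans_lt hx
  have h3 := Complex.hasSum_taylorSeries_neg_log h2
  rw [sub_neg_eq_add] at h3
  rw [← h1.unique h3]
  exact hs.hasSum

theorem exists_hasSum_neg_log_dirichlet (a : ι → ℂ) {freq : ι → ℝ} (hfreq : ∀ j, 0 < freq j) :
    ∃ x : ℝ, ∀ s : ℂ, x < s.re →
      HasSum (fun k : {k : ι → ℕ // k ≠ 0} =>
        logCoeff a k.1 * Complex.exp (-(pairing freq k.1 : ℂ) * s))
        (-Complex.log (dirichlet a freq s)) := by
  have hlim : Tendsto (fun x : ℝ => ∑ j, ‖a j‖ * Real.exp (-(freq j) * x)) atTop (𝓝 0) := by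
    rw [← Finset.sum_const_zero (s := (Finset.univ : Finset ι))]
    refine tendsto_finsetSum _ fun j _ => ?_
    rw [← mul_zero ‖a j‖]
    refine (Real.tendsto_exp_atBot.comp ?_).const_mul _
    exact tendsto_id.const_mul_atTop_of_neg (neg_neg_of_pos (hfreq j))
  obtain ⟨x, hx⟩ := eventually_atTop.mp (hlim.eventually (gt_mem_nhds one_pos))
  refine ⟨x, fun s hs => ?_⟩
  have hlt : ∑ j, ‖a j * Complex.exp (-(freq j : ℂ) * s)‖ < 1 := by
    refine lt_of_eq_of_lt (Finset.sum_congr rfl fun j _ => ?_) (hx s.re hs.le)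
    simp [Complex.norm_exp]
  have h := hasSum_logCoeff hlt
  have hk : ∀ k : ι → ℕ, logCoeff (fun j => a j * Complex.exp (-(freq j : ℂ) * s)) k =
      logCoeff a k * Complex.exp (-(pairing freq k : ℂ) * s) := by
    intro k
    rw [logCoeff_mul]
    congr 1
    simp only [← Complex.exp_nat_mul, ← Complex.exp_sum, pairing]
    congr 1
    push_cast
    rw [neg_mul, Finset.sum_mul, ← Finset.sum_neg_distrib]
    exact Finset.sum_congr rfl fun j _ => by ring
  rw [show logCoeff (fun j => a j * Complex.exp (-(freq j : ℂ) * s)) = _ from funext hk] at h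
  refine (hasSum_subtype_iff_of_support_subset (s := {k : ι → ℕ | k ≠ 0}) ?_).mpr h
  intro k hk0 h0
  subst h0
  simp [logCoeff_zero] at hk0

end Log

/-! ### Newton's relations -/

theorem one_add_sum_polyCoeff {n : ℕ} {P : Polynomial ℂ} (hP : P.Monic) (hdeg : P.natDegree = n)
    {w : ℂ} (hw : w ≠ 0) :
    1 + ∑ j, polyCoeff n P j * w ^ (j.val + 1) = w ^ n * P.eval w⁻¹ := by
  rw [Polynomial.eval_eq_sum_range, hdeg, ← Finset.sum_range_reflect, Finset.sum_range_succ',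
    mul_add, Finset.mul_sum, add_comm]
  congr 1
  · rw [Finset.sum_fin_eq_sum_range]
    refine Finset.sum_congr rfl fun i hi => ?_
    have hi' : i < n := Finset.mem_range.mp hi
    have e : n + 1 - 1 - (i + 1) = n - (i + 1) := by omega
    have e2 : w ^ n = w ^ (i + 1) * w ^ (n - (i + 1)) := by rw [← pow_add]; congr 1; omega
    rw [dif_pos hi', polyCoeff, e, inv_pow, e2]
    field_simp
  · have hl : P.coeff n = 1 := by rw [← hdeg]; exact hP
    simp [hl, hw]

theorem card_roots_eq {n : ℕ} {P : Polynomial ℂ} (hdeg : P.natDegree = n) :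
    P.roots.card = n := by
  rw [← hdeg]
  exact (IsAlgClosed.splits P).natDegree_eq_card_roots.symm

theorem one_add_sum_polyCoeff_eq_prod {n : ℕ} {P : Polynomial ℂ} (hP : P.Monic)
    (hdeg : P.natDegree = n) (w : ℂ) :
    1 + ∑ j, polyCoeff n P j * w ^ (j.val + 1) = (P.roots.map fun α => 1 - α * w).prod := by
  rcases eq_or_ne w 0 with rfl | hw
  · simp
  rw [one_add_sum_polyCoeff hP hdeg hw]
  conv_lhs => rw [(IsAlgClosed.splits P).eq_prod_roots_of_monic hP]
  rw [Polynomial.eval_multiset_prod, Multiset.map_map, ← card_roots_eq hdeg,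
    ← Multiset.card_map (fun α => 1 - α * w), ← Multiset.prod_replicate]
  rw [← Multiset.map_const', Multiset.map_map, ← Multiset.prod_map_mul]
  congr 1
  refine Multiset.map_congr rfl fun α _ => ?_
  simp
  field_simp

/-- The logarithmic series of the single factors are added, by induction on the multiset. -/
theorem eventually_hasSum_neg_log_prod (s : Multiset ℂ) :
    ∀ᶠ z : ℂ in 𝓝 0, HasSum (fun m : ℕ => z ^ m * ((s.map fun α => α ^ m).sum / m))
      (-Complex.log (s.map fun α => 1 - α * z).prod) := by
  induction s using Multiset.induction_on with
  | empty => simp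
  | cons a s ih =>
    have c1 : Tendsto (fun z : ℂ => 1 - a * z) (𝓝 0) (𝓝 1) :=
      Continuous.tendsto' (by fun_prop) _ _ (by simp)
    have c2 : Tendsto (fun z : ℂ => (s.map fun α => 1 - α * z).prod) (𝓝 0) (𝓝 1) :=
      Continuous.tendsto' (continuous_multiset_prod _ fun i _ => by fun_prop) _ _ (by simp)
    have harg : Tendsto Complex.arg (𝓝 1) (𝓝 0) := by
      have := Complex.continuousAt_arg (x := 1) (by simp)
      simpa [ContinuousAt] using this
    -- The principal logarithm is additive only while the sum of the arguments stays in `(-π, π]`;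
    -- near `z = 0` both factors are near `1`, so it does.
    have c3 := (harg.comp c1).add (harg.comp c2)
    rw [add_zero] at c3
    have c4 : ∀ᶠ z : ℂ in 𝓝 0, ‖a * z‖ < 1 := by
      have : Tendsto (fun z : ℂ => ‖a * z‖) (𝓝 0) (𝓝 0) :=
        Continuous.tendsto' (by fun_prop) _ _ (by simp)
      exact this.eventually (gt_mem_nhds one_pos)
    filter_upwards [ih, c4, c1.eventually_ne one_ne_zero, c2.eventually_ne one_ne_zero,
      c3.eventually (Ioc_mem_nhds (neg_neg_of_pos Real.pi_pos) Real.pi_pos)] with z h1 h2 h3 h4 h5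
    have h6 := (Complex.hasSum_taylorSeries_neg_log h2).add h1
    rw [Multiset.map_cons, Multiset.prod_cons, Complex.log_mul h3 h4 h5, neg_add]
    refine h6.congr_fun fun m => ?_
    rw [Multiset.map_cons, Multiset.sum_cons]
    ring

/-- With `x_j = a_j z^j` (subscripts from `1`), the monomial of index `k` carries `z` to its weight,
so grouping by weight yields a power series in `z`. -/
theorem eventually_hasSum_neg_log_weighted (n : ℕ) (a : Fin n → ℂ) :
    ∀ᶠ z : ℂ in 𝓝 0, HasSum (fun m : ℕ => z ^ m * ∑ k ∈ weighted n m, logCoeff a k)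
      (-Complex.log (1 + ∑ j, a j * z ^ (j.val + 1))) := by
  have c : Tendsto (fun z : ℂ => ∑ j, ‖a j * z ^ (j.val + 1)‖) (𝓝 0) (𝓝 0) :=
    Continuous.tendsto' (by fun_prop) _ _ (by simp)
  filter_upwards [c.eventually (gt_mem_nhds one_pos)] with z hz
  have h := hasSum_regroup (fun m k => mem_weighted (n := n) (m := m) (k := k))
    (hasSum_logCoeff hz)
  refine h.congr_fun fun m => ?_
  rw [Finset.mul_sum]
  refine Finset.sum_congr rfl fun k hk => ?_
  rw [logCoeff_mul, mul_comm]
  congr 1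
  simp_rw [← pow_mul]
  rw [Finset.prod_pow_eq_pow_sum, mem_weighted.mp hk]

theorem newtonRelations_logCoeff {n : ℕ} {P : Polynomial ℂ} (hP : P.Monic)
    (hdeg : P.natDegree = n) : NewtonRelations n P (logCoeff (polyCoeff n P)) := by
  intro m hm
  have h1 := eventually_hasSum_neg_log_weighted n (polyCoeff n P)
  have h2 := eventually_hasSum_neg_log_prod P.roots
  simp only [one_add_sum_polyCoeff_eq_prod hP hdeg] at h1
  set g : ℂ → ℂ := fun z => -Complex.log (P.roots.map fun α => 1 - α * z).prod
  -- Two scalar series converging to the same `g` near `0` are both its power series there, so their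
  -- coefficients agree.
  have key : ∀ u : ℕ → ℂ, (∀ᶠ z : ℂ in 𝓝 0, HasSum (fun m : ℕ => z ^ m * u m) (g z)) →
      HasFPowerSeriesAt g (FormalMultilinearSeries.ofScalars ℂ u) 0 := by
    intro u hu
    rw [hasFPowerSeriesAt_iff]
    filter_upwards [hu] with z hz
    simpa [FormalMultilinearSeries.coeff_ofScalars] using hz
  have h3 := (key _ h1).eq_formalMultilinearSeries (key _ h2)
  have h4 := congrArg (fun q => FormalMultilinearSeries.coeff q m) h3
  simp only [FormalMultilinearSeries.coeff_ofScalars] at h4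
  have hm0 : (m : ℂ) ≠ 0 := by exact_mod_cast (by omega : m ≠ 0)
  rw [h4, newtonSum]
  field_simp

theorem polyCoeff_eq_esymm {n : ℕ} {P : Polynomial ℂ} (hP : P.Monic) (hdeg : P.natDegree = n)
    (j : Fin n) : polyCoeff n P j = (-1) ^ (j.val + 1) * P.roots.esymm (j.val + 1) := by
  have hj := j.isLt
  rw [polyCoeff, Polynomial.coeff_eq_esymm_roots_of_card (by rw [card_roots_eq hdeg, hdeg])
    (by omega), hP.leadingCoeff, hdeg, show n - (n - (j.val + 1)) = j.val + 1 by omega, one_mul]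

theorem logCoeff_polyCoeff_eq_esymm {n : ℕ} {P : Polynomial ℂ} (hP : P.Monic)
    (hdeg : P.natDegree = n) {m : ℕ} (hm : 1 ≤ m) {k : Fin n → ℕ} (hk : k ∈ weighted n m) :
    logCoeff (polyCoeff n P) k =
      (-1) ^ (m + ∑ j, k j) * (Nat.factorial ((∑ j, k j) - 1) : ℂ) /
        ((∏ j, Nat.factorial (k j) : ℕ) : ℂ) * ∏ j, P.roots.esymm (j.val + 1) ^ k j := by
  rw [mem_weighted] at hk
  -- Weight `m ≥ 1` forces `k ≠ 0`, so the factor `‖k‖!/‖k‖` really is `(‖k‖ - 1)!`.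
  have hN : ∑ j, k j ≠ 0 := by
    intro h
    rw [Finset.sum_eq_zero_iff] at h
    rw [Finset.sum_eq_zero fun j hj => by rw [h j hj, mul_zero]] at hk
    omega
  obtain ⟨N, hN'⟩ := Nat.exists_eq_succ_of_ne_zero hN
  have hprod : ∏ j, polyCoeff n P j ^ k j =
      (-1) ^ m * ∏ j, P.roots.esymm (j.val + 1) ^ k j := by
    simp_rw [polyCoeff_eq_esymm hP hdeg, mul_pow, Finset.prod_mul_distrib, ← pow_mul]
    rw [Finset.prod_pow_eq_pow_sum, hk]
  rw [logCoeff, hprod, hN']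
  have : ((N + 1 : ℕ) : ℂ) ≠ 0 := by exact_mod_cast N.succ_ne_zero
  simp only [Nat.succ_eq_add_one, Nat.add_sub_cancel, Nat.factorial_succ]
  rw [Nat.cast_mul]
  field_simp
  ring

/-! ### Distributions carried by the multiples of `lam` -/

section Combs

variable {lam : ℝ}

theorem exists_forall_multiple_notMem (hlam : 0 < lam) {K : Set ℝ} (hK : IsCompact K) :
    ∃ M : ℕ, ∀ m, M ≤ m → (m : ℝ) * lam ∉ K := by
  obtain ⟨R, hR⟩ := hK.bddAbove
  obtain ⟨M, hM⟩ := exists_nat_gt (R / lam)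
  refine ⟨M, fun m hm hmem => ?_⟩
  have h1 := hR hmem
  rw [div_lt_iff₀ hlam] at hM
  have h2 : (M : ℝ) * lam ≤ m * lam := by gcongr
  linarith

theorem exists_forall_testFunction_eq_zero (hlam : 0 < lam) (φ : 𝓓(posReals, ℝ)) :
    ∃ M : ℕ, ∀ m : ℕ, M ≤ m → φ ((m : ℝ) * lam) = 0 := by
  obtain ⟨M, hM⟩ := exists_forall_multiple_notMem hlam φ.hasCompactSupport
  exact ⟨M, fun m hm => image_eq_zero_of_notMem_tsupport (hM m hm)⟩

theorem testFunction_eq_zero_of_nonpos (φ : 𝓓(posReals, ℝ)) {t : ℝ} (ht : t ≤ 0) : φ t = 0 :=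
  image_eq_zero_of_notMem_tsupport fun h => not_lt.mpr ht (φ.tsupport_subset h)

theorem summable_comb (hlam : 0 < lam) (S : ℕ → ℂ) (φ : 𝓓(posReals, ℝ)) :
    Summable fun m : ℕ => (lam : ℂ) * S (m + 1) * (φ (((m + 1 : ℕ) : ℝ) * lam) : ℂ) := by
  obtain ⟨M, hM⟩ := exists_forall_testFunction_eq_zero hlam φ
  refine summable_of_ne_finset_zero (s := Finset.range M) fun m hm => ?_
  rw [hM _ (by simp at hm; omega)]
  simp

/-- The distribution `lam ∑_{m ≥ 1} S_m δ_{m lam}` on the positive half line. -/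
def comb (hlam : 0 < lam) (S : ℕ → ℂ) : 𝓓'(posReals, ℂ) :=
  TestFunction.mkCLM ℝ
    (fun φ => ∑' m : ℕ, (lam : ℂ) * S (m + 1) * (φ (((m + 1 : ℕ) : ℝ) * lam) : ℂ))
    (fun φ ψ => by
      rw [← (summable_comb hlam S φ).tsum_add (summable_comb hlam S ψ)]
      refine tsum_congr fun m => ?_
      rw [add_apply, Complex.ofReal_add, mul_add])
    (fun c φ => by
      rw [← (summable_comb hlam S φ).tsum_const_smul]
      refine tsum_congr fun m => ?_
      rw [smul_apply, smul_eq_mul, Complex.ofReal_mul, Complex.real_smul]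
      ring)
    -- Continuity is checked on test functions supported in a fixed compact set, where the series is
    -- one finite sum of point evaluations.
    (fun K hK => by
      obtain ⟨M, hM⟩ := exists_forall_multiple_notMem hlam K.isCompact
      have h : ∀ φ : ContDiffMapSupportedIn ℝ ℝ ⊤ K,
          ∑' m : ℕ, (lam : ℂ) * S (m + 1) *
            (TestFunction.ofSupportedIn hK φ (((m + 1 : ℕ) : ℝ) * lam) : ℂ) =
          ∑ m ∈ Finset.range M, (lam : ℂ) * S (m + 1) *
            (TestFunction.ofSupportedIn hK φ (((m + 1 : ℕ) : ℝ) * lam) : ℂ) := by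
        intro φ
        refine tsum_eq_sum fun m hm => ?_
        have h0 : TestFunction.ofSupportedIn hK φ (((m + 1 : ℕ) : ℝ) * lam) = 0 :=
          φ.zero_on_compl (hM (m + 1) (by simp at hm; omega))
        rw [h0]
        simp
      refine Continuous.congr ?_ fun φ => (h φ).symm
      refine continuous_finsetSum _ fun m _ => continuous_const.mul ?_
      exact Complex.continuous_ofReal.comp
        ((continuous_eval_const _).comp (TestFunction.continuous_ofSupportedIn hK)))

theorem hasSum_comb (hlam : 0 < lam) (S : ℕ → ℂ) (φ : 𝓓(posReals, ℝ)) :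
    HasSum (fun m : ℕ => (lam : ℂ) * S (m + 1) * (φ (((m + 1 : ℕ) : ℝ) * lam) : ℂ))
      (comb hlam S φ) :=
  (summable_comb hlam S φ).hasSum

/-- The index `m = 0` is harmless because test functions vanish at `0`. -/
theorem hasSum_comb_nat (hlam : 0 < lam) (S : ℕ → ℂ) (φ : 𝓓(posReals, ℝ)) :
    HasSum (fun m : ℕ => (lam : ℂ) * S m * (φ ((m : ℝ) * lam) : ℂ)) (comb hlam S φ) := by
  have h := (hasSum_nat_add_iff (f := fun m : ℕ => (lam : ℂ) * S m * (φ ((m : ℝ) * lam) : ℂ)) 1).mp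
    (hasSum_comb hlam S φ)
  simpa [testFunction_eq_zero_of_nonpos φ le_rfl] using h

theorem pairing_multiples (n : ℕ) (lam : ℝ) (k : Fin n → ℕ) :
    pairing (multiples n lam) k = ((∑ j, (j.val + 1) * k j : ℕ) : ℝ) * lam := by
  simp only [pairing, multiples]
  push_cast
  rw [Finset.sum_mul]
  exact Finset.sum_congr rfl fun j _ => by ring

/-- The frequency of `k` depends only on its weight. A given `φ` meets finitely many weights, each
with finitely many `k`, so regrouping is reversible without any growth condition on `c`. -/
theorem hasSum_formula_iff (hlam : 0 < lam) {n : ℕ} (c : (Fin n → ℕ) → ℂ) (φ : 𝓓(posReals, ℝ))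
    (w : ℂ) :
    HasSum (fun k : {k : Fin n → ℕ // k ≠ 0} => (pairing (multiples n lam) k.1 : ℂ) * c k.1 *
        (φ (pairing (multiples n lam) k.1) : ℂ)) w ↔
      HasSum (fun m : ℕ => (lam : ℂ) * ((m : ℂ) * ∑ k ∈ weighted n m, c k) *
        (φ ((m : ℝ) * lam) : ℂ)) w := by
  set g : (Fin n → ℕ) → ℂ := fun k => (pairing (multiples n lam) k : ℂ) * c k *
    (φ (pairing (multiples n lam) k) : ℂ) with hg
  have h1 : HasSum (fun k : {k : Fin n → ℕ // k ≠ 0} => g k.1) w ↔ HasSum g w := by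
    have hsupp : Function.support g ⊆ {k : Fin n → ℕ | k ≠ 0} := by
      intro k hk0 h0
      subst h0
      simp [hg, pairing] at hk0
    exact hasSum_subtype_iff_of_support_subset hsupp
  have hS : Summable g := by
    obtain ⟨M, hM⟩ := exists_forall_testFunction_eq_zero hlam φ
    refine summable_of_ne_finset_zero (s := (Finset.range M).biUnion (weighted n)) fun k hk => ?_
    have : M ≤ ∑ j : Fin n, (j.val + 1) * k j := by
      by_contra hlt
      exact hk (Finset.mem_biUnion.mpr ⟨_, Finset.mem_range.mpr (not_le.mp hlt),
        mem_weighted.mpr rfl⟩)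
    simp only [hg]
    rw [pairing_multiples, hM _ this]
    simp
  have h2 : ∀ v, HasSum g v → HasSum (fun m : ℕ => (lam : ℂ) * ((m : ℂ) * ∑ k ∈ weighted n m, c k) *
        (φ ((m : ℝ) * lam) : ℂ)) v := by
    intro v hv
    refine (hasSum_regroup (fun m k => mem_weighted (n := n) (m := m) (k := k)) hv).congr_fun
      fun m => ?_
    rw [Finset.mul_sum, Finset.mul_sum, Finset.sum_mul]
    refine Finset.sum_congr rfl fun k hk => ?_
    simp only [hg]
    rw [pairing_multiples, mem_weighted.mp hk]
    push_cast
    ring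
  rw [h1]
  refine ⟨h2 w, fun h => ?_⟩
  rw [h.unique (h2 _ hS.hasSum)]
  exact hS.hasSum

theorem exists_testFunction_isolating (hlam : 0 < lam) {m : ℕ} (hm : 1 ≤ m) :
    ∃ φ : 𝓓(posReals, ℝ), φ ((m : ℝ) * lam) = 1 ∧ ∀ i : ℕ, i ≠ m → φ ((i : ℝ) * lam) = 0 := by
  -- Radius `lam` excludes all other multiples and, since `m ≥ 1`, keeps the ball in the positive
  -- half line.
  have hnhds : Metric.ball ((m : ℝ) * lam) lam ∈ 𝓝 ((m : ℝ) * lam) := Metric.ball_mem_nhds _ hlam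
  obtain ⟨g, hg1, hg2, hg3, -, hg5⟩ := exists_contDiff_tsupport_subset (n := ⊤) hnhds
  have hm' : (1 : ℝ) ≤ m := by exact_mod_cast hm
  have hsub : tsupport g ⊆ posReals := by
    intro t ht
    have := hg1 ht
    rw [Real.ball_eq_Ioo] at this
    have h2 : lam ≤ m * lam := le_mul_of_one_le_left hlam.le hm'
    change 0 < t
    linarith [this.1]
  refine ⟨⟨g, hg3, hg2, hsub⟩, hg5, fun i hi => ?_⟩
  refine image_eq_zero_of_notMem_tsupport (f := g) fun ht => ?_
  have := hg1 ht
  rw [Metric.mem_ball, Real.dist_eq, ← sub_mul, abs_mul, abs_of_pos hlam] at this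
  have h1 : (1 : ℝ) ≤ |(i : ℝ) - m| := by
    have : (1 : ℤ) ≤ |(i : ℤ) - m| := Int.one_le_abs (by omega)
    exact_mod_cast this
  nlinarith

theorem formula_comb_iff (hlam : 0 < lam) (n : ℕ) (P : Polynomial ℂ) (c : (Fin n → ℕ) → ℂ) :
    Formula (multiples n lam) c (comb hlam (newtonSum P)) ↔ NewtonRelations n P c := by
  unfold Formula NewtonRelations
  simp only [hasSum_formula_iff hlam]
  constructor
  · intro h m hm
    obtain ⟨φ, h1, h0⟩ := exists_testFunction_isolating hlam hm
    have e1 := hasSum_single (f := fun i : ℕ => (lam : ℂ) * ((i : ℂ) * ∑ k ∈ weighted n i, c k) *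
        (φ ((i : ℝ) * lam) : ℂ)) m fun i hi => by rw [h0 i hi]; simp
    have e2 := hasSum_single (f := fun i : ℕ => (lam : ℂ) * newtonSum P i *
        (φ ((i : ℝ) * lam) : ℂ)) m fun i hi => by rw [h0 i hi]; simp
    have e3 := ((h φ).unique e1).symm.trans ((hasSum_comb_nat hlam (newtonSum P) φ).unique e2)
    rw [h1] at e3
    have hl : (lam : ℂ) ≠ 0 := by exact_mod_cast hlam.ne'
    simpa [hl] using e3.symm
  · intro h φ
    refine (hasSum_comb_nat hlam (newtonSum P) φ).congr_fun fun m => ?_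
    rcases Nat.eq_zero_or_pos m with rfl | hm
    · simp [testFunction_eq_zero_of_nonpos φ le_rfl]
    · rw [h m hm]

end Combs

/-! ### The divisor of the Dirichlet series of a polynomial -/

section Divisor

variable {lam : ℝ}

theorem meromorphicOrderAt_polynomial_eval {P : Polynomial ℂ} (hP : P ≠ 0) (z : ℂ) :
    meromorphicOrderAt (fun x => P.eval x) z = (P.rootMultiplicity z : ℤ) := by
  obtain ⟨q, hq, hnd⟩ := P.exists_eq_pow_rootMultiplicity_mul_and_not_dvd hP z
  have han : ∀ p : Polynomial ℂ, AnalyticAt ℂ (fun x => p.eval x) z := fun p =>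
    (Differentiable.analyticAt (by fun_prop) z)
  rw [meromorphicOrderAt_eq_int_iff (han P).meromorphicAt]
  refine ⟨fun x => q.eval x, han q, ?_, Eventually.of_forall fun x => ?_⟩
  · rwa [Ne, ← Polynomial.IsRoot.def, ← Polynomial.dvd_iff_isRoot]
  · conv_lhs => rw [hq]
    simp

/-- The exponential prefactor never vanishes, and `s ↦ e^{lam s}` has nonzero derivative, so
composing with it preserves orders of vanishing. -/
theorem mult_exp_mul_eval {P : Polynomial ℂ} (hP : P ≠ 0) (hlam : 0 < lam) (c : ℂ) {f : ℂ → ℂ}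
    (hf : ∀ s, f s = Complex.exp (c * s) * P.eval (Complex.exp (lam * s))) (ρ : ℂ) :
    mult f ρ = P.rootMultiplicity (Complex.exp (lam * ρ)) := by
  have hE : ∀ z, AnalyticAt ℂ (fun s : ℂ => Complex.exp (c * s)) z := fun z =>
    Differentiable.analyticAt (by fun_prop) z
  have hQ : ∀ z, AnalyticAt ℂ ((fun x => P.eval x) ∘ fun s : ℂ => Complex.exp (lam * s)) z :=
    fun z => Differentiable.analyticAt (by
      exact Differentiable.comp (by fun_prop) (by fun_prop)) z
  have hg : AnalyticAt ℂ (fun s : ℂ => Complex.exp (lam * s)) ρ :=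
    Differentiable.analyticAt (by fun_prop) ρ
  have hl : (lam : ℂ) ≠ 0 := by exact_mod_cast hlam.ne'
  have hd : deriv (fun s : ℂ => Complex.exp (lam * s)) ρ ≠ 0 := by
    have : HasDerivAt (fun s : ℂ => Complex.exp (lam * s))
        (Complex.exp (lam * ρ) * (lam * 1)) ρ := ((hasDerivAt_id ρ).const_mul (lam : ℂ)).cexp
    rw [this.deriv]
    simp [hl]
  have hf' : f = (fun s : ℂ => Complex.exp (c * s)) *
      ((fun x => P.eval x) ∘ fun s : ℂ => Complex.exp (lam * s)) := funext hf
  have hmer : MeromorphicOn f Set.univ := fun z _ => by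
    rw [hf']
    exact ((hE z).mul (hQ z)).meromorphicAt
  have h0 : meromorphicOrderAt (fun s : ℂ => Complex.exp (c * s)) ρ = 0 := by
    rw [(hE ρ).meromorphicOrderAt_eq,
      (hE ρ).analyticOrderAt_eq_zero.mpr (Complex.exp_ne_zero _)]
    rfl
  rw [mult, MeromorphicOn.divisor_apply hmer (Set.mem_univ _), hf',
    meromorphicOrderAt_mul (hE ρ).meromorphicAt (hQ ρ).meromorphicAt, h0, zero_add,
    meromorphicOrderAt_comp_of_deriv_ne_zero hg hd, meromorphicOrderAt_polynomial_eval hP]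
  rfl

theorem hasSum_multiset {β γ E : Type*} [AddCommMonoid E] [TopologicalSpace E] [ContinuousAdd E]
    {s : Multiset γ} {G : γ → β → E} {v : γ → E} (h : ∀ a ∈ s, HasSum (G a) (v a)) :
    HasSum (fun b => (s.map fun a => G a b).sum) (s.map v).sum := by
  induction s using Multiset.induction_on with
  | empty => simp
  | cons a s ih =>
    simp only [Multiset.map_cons, Multiset.sum_cons]
    exact (h a (Multiset.mem_cons_self a s)).add
      (ih fun b hb => h b (Multiset.mem_cons_of_mem hb))

/-- Splits a sum over the divisor into one sum per root, so that each `α` can be treated separately.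
-/
theorem rootMultiplicity_mul_eq_sum (P : Polynomial ℂ) (z y : ℂ) :
    (P.rootMultiplicity z : ℂ) * y = (P.roots.map fun α => if z = α then y else 0).sum := by
  classical
  rw [← Polynomial.count_roots]
  induction P.roots using Multiset.induction_on with
  | empty => simp
  | cons a s ih =>
    rw [Multiset.map_cons, Multiset.sum_cons, Multiset.count_cons, Nat.cast_add, add_mul, ih,
      add_comm]
    congr 1
    split_ifs <;> simp

theorem rootMultiplicity_mul_eq_sum_real (P : Polynomial ℂ) (z : ℂ) (y : ℝ) :
    (P.rootMultiplicity z : ℝ) * y = (P.roots.map fun α => if z = α then y else 0).sum := by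
  classical
  rw [← Polynomial.count_roots]
  induction P.roots using Multiset.induction_on with
  | empty => simp
  | cons a s ih =>
    rw [Multiset.map_cons, Multiset.sum_cons, Multiset.count_cons, Nat.cast_add, add_mul, ih,
      add_comm]
    congr 1
    split_ifs <;> simp

/-- The solutions `(log α + 2 π i k) / lam` of `e^{lam ρ} = α`. -/
def logBranch (lam : ℝ) (α : ℂ) (k : ℤ) : ℂ :=
  (Complex.log α + k * (2 * Real.pi * Complex.I)) / lam

theorem logBranch_injective (hlam : 0 < lam) (α : ℂ) : Function.Injective (logBranch lam α) := by
  intro k l h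
  have hl : (lam : ℂ) ≠ 0 := by exact_mod_cast hlam.ne'
  rw [logBranch, logBranch, div_left_inj' hl, add_right_inj,
    mul_left_inj' Complex.two_pi_I_ne_zero] at h
  exact_mod_cast h

theorem exp_mul_eq_iff (hlam : 0 < lam) {α : ℂ} (hα : α ≠ 0) (ρ : ℂ) :
    Complex.exp (lam * ρ) = α ↔ ρ ∈ Set.range (logBranch lam α) := by
  have hl : (lam : ℂ) ≠ 0 := by exact_mod_cast hlam.ne'
  conv_lhs => rw [← Complex.exp_log hα, Complex.exp_eq_exp_iff_exists_int]
  refine exists_congr fun k => ?_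
  rw [logBranch, div_eq_iff hl, mul_comm ρ, eq_comm]

theorem hasSum_ite_exp_iff {E : Type*} [AddCommMonoid E] [TopologicalSpace E] (hlam : 0 < lam)
    {α : ℂ} (hα : α ≠ 0) (g : ℂ → E) (v : E) :
    HasSum (fun ρ => if Complex.exp (lam * ρ) = α then g ρ else 0) v ↔
      HasSum (fun k => g (logBranch lam α k)) v := by
  rw [← (logBranch_injective hlam α).hasSum_iff]
  · refine iff_of_eq (congrArg (fun q => HasSum q v) (funext fun k => ?_))
    exact if_pos ((exp_mul_eq_iff hlam hα _).mpr ⟨k, rfl⟩)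
  · intro ρ hρ
    exact if_neg fun h => hρ ((exp_mul_eq_iff hlam hα _).mp h)

theorem summable_norm_logBranch (hlam : 0 < lam) (α : ℂ) :
    Summable fun k : ℤ => ‖logBranch lam α k‖ ^ (-2 : ℤ) := by
  -- The imaginary part of the `k`-th branch is `(2π / lam)(k + a)`, which allows comparison with `∑
  -- |k + a|^{-2}`. At most one `k` has `k + a = 0`, and it is discarded.
  set a : ℝ := Complex.arg α / (2 * Real.pi) with ha
  have hs := ((Real.summable_one_div_int_add_rpow a 2).mpr one_lt_two).mul_left
    ((2 * Real.pi / lam) ^ (-2 : ℤ))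
  refine Summable.of_norm_bounded_eventually hs ?_
  have hfin : {k : ℤ | (k : ℝ) + a = 0}.Finite := by
    refine Set.Subsingleton.finite fun k hk l hl => ?_
    have : (k : ℝ) = l := by
      simp only [Set.mem_ofPred_eq] at hk hl
      linarith
    exact_mod_cast this
  filter_upwards [hfin.compl_mem_cofinite] with k hk
  have hk' : 0 < |(k : ℝ) + a| := abs_pos.mpr hk
  have him : (logBranch lam α k).im = 2 * Real.pi / lam * (k + a) := by
    rw [logBranch, Complex.div_ofReal_im, ha]
    simp [Complex.log_im]
    field_simp
    ring
  have hle : 2 * Real.pi / lam * |(k : ℝ) + a| ≤ ‖logBranch lam α k‖ := by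
    refine le_trans (le_of_eq ?_) (Complex.abs_im_le_norm _)
    rw [him, abs_mul, abs_of_pos (by positivity : 0 < 2 * Real.pi / lam)]
  have hpos : 0 < 2 * Real.pi / lam * |(k : ℝ) + a| := by positivity
  have h2 : |(k : ℝ) + a| ^ (2 : ℝ) = |(k : ℝ) + a| ^ (2 : ℕ) := by
    rw [← Real.rpow_natCast]; norm_num
  rw [Real.norm_of_nonneg (by positivity), h2, zpow_neg, zpow_neg, one_div, ← mul_inv]
  refine inv_anti₀ (by positivity) ?_
  have := pow_le_pow_left₀ hpos.le hle 2
  rw [mul_pow] at this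
  exact_mod_cast this

/-- Shows that `2` is an admissible exponent, so the infimum defining `convExponent` is attained. -/
theorem summable_rootMultiplicity (hlam : 0 < lam) (P : Polynomial ℂ) :
    Summable fun ρ : ℂ =>
      (P.rootMultiplicity (Complex.exp (lam * ρ)) : ℝ) * ‖ρ‖ ^ (-2 : ℤ) := by
  simp only [rootMultiplicity_mul_eq_sum_real]
  have key : ∀ α : ℂ, Summable fun ρ : ℂ =>
      if Complex.exp (lam * ρ) = α then ‖ρ‖ ^ (-2 : ℤ) else 0 := by
    intro α
    rcases eq_or_ne α 0 with rfl | hα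
    · simp [Complex.exp_ne_zero, summable_zero]
    · exact ⟨_, (hasSum_ite_exp_iff hlam hα _ _).mpr (summable_norm_logBranch hlam α).hasSum⟩
  exact ⟨_, hasSum_multiset fun α _ => (key α).hasSum⟩

end Divisor

/-! ### Poisson summation over the solutions of `e^{lam ρ} = α` -/

section Poisson

variable {lam : ℝ}

theorem contDiff_testFunction (φ : 𝓓(posReals, ℝ)) :
    ContDiff ℝ (⊤ : ℕ∞) fun t => (φ t : ℂ) :=
  Complex.ofRealCLM.contDiff.comp φ.contDiff

theorem hasCompactSupport_testFunction (φ : 𝓓(posReals, ℝ)) :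
    HasCompactSupport fun t => (φ t : ℂ) :=
  φ.hasCompactSupport.comp_left (g := fun x : ℝ => (x : ℂ)) Complex.ofReal_zero

/-- Poisson summation for `h(u) = e^{u log α} φ(lam u)`: the values at integers are `α^m φ(m lam)`,
and the substitution `t = lam u` turns the Fourier coefficients into the integrals. -/
theorem hasSum_integral_logBranch (hlam : 0 < lam) {α : ℂ} (hα : α ≠ 0) (φ : 𝓓(posReals, ℝ)) :
    HasSum (fun k : ℤ => ∫ t : ℝ, Complex.exp (logBranch lam α k * (t : ℂ)) * (φ t : ℂ))
      (comb hlam (fun m => α ^ m) φ) := by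
  have hl : (lam : ℂ) ≠ 0 := by exact_mod_cast hlam.ne'
  have hsm : ContDiff ℝ (⊤ : ℕ∞) fun u : ℝ =>
      Complex.exp (Complex.log α * (u : ℂ)) * (φ (lam * u) : ℂ) := by
    have h1 : ContDiff ℝ (⊤ : ℕ∞) fun u : ℝ => (u : ℂ) := Complex.ofRealCLM.contDiff
    have h2 : ContDiff ℝ (⊤ : ℕ∞) fun u : ℝ => (φ (lam * u) : ℂ) :=
      (contDiff_testFunction φ).comp (contDiff_const.mul contDiff_id)
    exact (contDiff_const.mul h1).cexp.mul h2
  have hcs : HasCompactSupport fun u : ℝ =>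
      Complex.exp (Complex.log α * (u : ℂ)) * (φ (lam * u) : ℂ) := by
    refine HasCompactSupport.mul_left ?_
    exact (hasCompactSupport_testFunction φ).comp_homeomorph (Homeomorph.mulLeft₀ lam hlam.ne')
  set h : SchwartzMap ℝ ℂ := hcs.toSchwartzMap hsm with hh
  have happ : ∀ u, h u = Complex.exp (Complex.log α * (u : ℂ)) * (φ (lam * u) : ℂ) := fun u => rfl
  have hnat : HasSum (fun n : ℤ => (lam : ℂ) * h n) (comb hlam (fun m => α ^ m) φ) := by
    rw [← (Nat.cast_injective (R := ℤ)).hasSum_iff]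
    · refine (hasSum_comb_nat hlam (fun m => α ^ m) φ).congr_fun fun m => ?_
      simp only [Function.comp_apply, happ]
      push_cast
      rw [mul_comm (Complex.log α), Complex.exp_nat_mul, Complex.exp_log hα, mul_comm lam, mul_assoc]
    · intro n hn
      have hn0 : n ≤ 0 := by
        by_contra hlt
        exact hn ⟨n.toNat, Int.toNat_of_nonneg (by omega)⟩
      rw [happ, testFunction_eq_zero_of_nonpos φ
        (mul_nonpos_of_nonneg_of_nonpos hlam.le (by exact_mod_cast hn0))]
      simp
  have hpois := h.tsum_eq_tsum_fourier 0
  simp only [zero_add, AddCircle.coe_zero, fourier_eval_zero, mul_one] at hpois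
  -- `HasSum` needs unconditional convergence on the Fourier side, which Schwartz decay of order
  -- `|n|^{-2}` supplies.
  have hsumF : Summable fun n : ℤ => (FourierTransform.fourier h : SchwartzMap ℝ ℂ) n := by
    refine summable_of_isBigO (Real.summable_abs_int_rpow one_lt_two) ?_
    exact ((FourierTransform.fourier h : SchwartzMap ℝ ℂ).isBigO_cocompact_rpow (-2)).comp_tendsto
      Int.tendsto_coe_cofinite
  have hF : HasSum (fun n : ℤ => (lam : ℂ) * (FourierTransform.fourier h : SchwartzMap ℝ ℂ) n)
      (comb hlam (fun m => α ^ m) φ) := by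
    rw [← hnat.tsum_eq, tsum_mul_left, hpois]
    exact hsumF.hasSum.mul_left _
  rw [← (Equiv.neg ℤ).hasSum_iff] at hF
  refine hF.congr_fun fun k => ?_
  simp only [Function.comp_apply, Equiv.neg_apply]
  rw [SchwartzMap.fourier_coe, Real.fourier_real_eq_integral_exp_smul]
  have hcv := Measure.integral_comp_mul_left
    (fun t : ℝ => Complex.exp (logBranch lam α k * (t : ℂ)) * (φ t : ℂ)) lam
  rw [abs_of_pos (inv_pos.mpr hlam), eq_inv_smul_iff₀ hlam.ne', Complex.real_smul] at hcv
  rw [← hcv]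
  congr 1
  refine integral_congr_ae (Eventually.of_forall fun u => ?_)
  simp only [happ, smul_eq_mul]
  rw [← mul_assoc, ← Complex.exp_add]
  congr 2
  rw [logBranch]
  push_cast
  field_simp
  ring

theorem hasSum_rootMultiplicity_integral (hlam : 0 < lam) (P : Polynomial ℂ)
    (φ : 𝓓(posReals, ℝ)) :
    HasSum (fun ρ : ℂ => (P.rootMultiplicity (Complex.exp (lam * ρ)) : ℂ) *
      ∫ t : ℝ, Complex.exp (ρ * (t : ℂ)) * (φ t : ℂ)) (comb hlam (newtonSum P) φ) := by
  have key : ∀ α : ℂ, HasSum (fun ρ : ℂ => if Complex.exp (lam * ρ) = α then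
      ∫ t : ℝ, Complex.exp (ρ * (t : ℂ)) * (φ t : ℂ) else 0) (comb hlam (fun m => α ^ m) φ) := by
    intro α
    rcases eq_or_ne α 0 with rfl | hα
    · have h := (hasSum_comb hlam (fun m => (0 : ℂ) ^ m) φ).unique
        (hasSum_zero.congr_fun fun m => by simp)
      rw [h]
      simp [Complex.exp_ne_zero]
    · exact (hasSum_ite_exp_iff hlam hα _ _).mpr (hasSum_integral_logBranch hlam hα φ)
  have h := hasSum_multiset (s := P.roots) fun α _ => key α
  have h2 := hasSum_multiset (s := P.roots) fun α _ => hasSum_comb hlam (fun m => α ^ m) φ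
  have e : (P.roots.map fun α => comb hlam (fun m => α ^ m) φ).sum = comb hlam (newtonSum P) φ := by
    refine h2.unique ((hasSum_comb hlam (newtonSum P) φ).congr_fun fun m => ?_)
    rw [newtonSum, Multiset.sum_map_mul_right, Multiset.sum_map_mul_left]
  rw [e] at h
  exact h.congr_fun fun ρ => (rootMultiplicity_mul_eq_sum P _ _)

end Poisson

/-! ### Integration by parts against test functions -/

section Parts

theorem tsupport_iteratedDeriv_subset (ψ : ℝ → ℂ) (d : ℕ) :
    tsupport (iteratedDeriv d ψ) ⊆ tsupport ψ := by
  induction d with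
  | zero => simp
  | succ d ih =>
    rw [iteratedDeriv_succ]
    exact (closure_minimal support_deriv_subset (isClosed_tsupport _)).trans ih

theorem hasCompactSupport_iteratedDeriv {ψ : ℝ → ℂ} (hc : HasCompactSupport ψ) (d : ℕ) :
    HasCompactSupport (iteratedDeriv d ψ) :=
  hc.of_isClosed_subset (isClosed_tsupport _) (tsupport_iteratedDeriv_subset ψ d)

theorem contDiff_iteratedDeriv {ψ : ℝ → ℂ} (hs : ContDiff ℝ (⊤ : ℕ∞) ψ) (d : ℕ) :
    ContDiff ℝ (⊤ : ℕ∞) (iteratedDeriv d ψ) := by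
  induction d with
  | zero => simpa using hs
  | succ d ih =>
    rw [iteratedDeriv_succ]
    exact (contDiff_infty_iff_deriv.mp ih).2

theorem integrable_mul_of_hasCompactSupport {u ψ : ℝ → ℂ} (hu : Continuous u)
    (hψ : Continuous ψ) (hc : HasCompactSupport ψ) : Integrable fun t => u t * ψ t :=
  (hu.mul hψ).integrable_of_hasCompactSupport hc.mul_left

theorem integral_mul_deriv_of_hasCompactSupport {u u' ψ : ℝ → ℂ}
    (hu : ∀ t, HasDerivAt u (u' t) t) (hu' : Continuous u') (hs : ContDiff ℝ (⊤ : ℕ∞) ψ)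
    (hc : HasCompactSupport ψ) : ∫ t, u t * deriv ψ t = -∫ t, u' t * ψ t := by
  have hcu : Continuous u := continuous_iff_continuousAt.mpr fun t => (hu t).continuousAt
  have hs' := contDiff_infty_iff_deriv.mp hs
  exact integral_mul_deriv_eq_deriv_mul_of_integrable (fun t _ => hu t)
    (fun t _ => (hs'.1 t).hasDerivAt)
    (integrable_mul_of_hasCompactSupport hcu hs'.2.continuous hc.deriv)
    (integrable_mul_of_hasCompactSupport hu' hs.continuous hc)
    (integrable_mul_of_hasCompactSupport hcu hs.continuous hc)

theorem hasDerivAt_exp_mul_ofReal (μ : ℂ) (t : ℝ) :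
    HasDerivAt (fun t : ℝ => Complex.exp (μ * (t : ℂ))) (μ * Complex.exp (μ * (t : ℂ))) t := by
  have h : HasDerivAt (fun t : ℝ => μ * (t : ℂ)) (μ * 1) t :=
    (Complex.ofRealCLM.hasDerivAt (x := t)).const_mul μ
  simpa [mul_comm] using h.cexp

theorem integral_exp_mul_iteratedDeriv (μ : ℂ) (d : ℕ) {ψ : ℝ → ℂ}
    (hs : ContDiff ℝ (⊤ : ℕ∞) ψ) (hc : HasCompactSupport ψ) :
    ∫ t : ℝ, Complex.exp (μ * (t : ℂ)) * iteratedDeriv d ψ t =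
      (-μ) ^ d * ∫ t : ℝ, Complex.exp (μ * (t : ℂ)) * ψ t := by
  induction d with
  | zero => simp
  | succ d ih =>
    rw [iteratedDeriv_succ, integral_mul_deriv_of_hasCompactSupport
      (hasDerivAt_exp_mul_ofReal μ) (by fun_prop) (contDiff_iteratedDeriv hs d)
      (hasCompactSupport_iteratedDeriv hc d)]
    simp_rw [mul_assoc]
    rw [integral_const_mul, ih]
    ring

theorem integral_pow_mul_iteratedDeriv (d : ℕ) {ψ : ℝ → ℂ}
    (hs : ContDiff ℝ (⊤ : ℕ∞) ψ) (hc : HasCompactSupport ψ) :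
    ∫ t : ℝ, (t : ℂ) ^ d / (Nat.factorial d : ℂ) * iteratedDeriv d ψ t =
      (-1) ^ d * ∫ t : ℝ, ψ t := by
  induction d with
  | zero => simp
  | succ d ih =>
    have hder : ∀ t : ℝ, HasDerivAt (fun t : ℝ => (t : ℂ) ^ (d + 1) / (Nat.factorial (d + 1) : ℂ))
        ((t : ℂ) ^ d / (Nat.factorial d : ℂ)) t := by
      intro t
      have h : HasDerivAt (fun t : ℝ => (t : ℂ)) 1 t := Complex.ofRealCLM.hasDerivAt (x := t)
      refine ((h.pow (d + 1)).div_const (Nat.factorial (d + 1) : ℂ)).congr_deriv ?_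
      have h1 : (Nat.factorial d : ℂ) ≠ 0 := by exact_mod_cast Nat.factorial_ne_zero d
      have h2 : ((d : ℂ) + 1) ≠ 0 := by exact_mod_cast d.succ_ne_zero
      rw [Nat.factorial_succ]
      push_cast
      field_simp
    rw [iteratedDeriv_succ, integral_mul_deriv_of_hasCompactSupport hder (by fun_prop)
      (contDiff_iteratedDeriv hs d) (hasCompactSupport_iteratedDeriv hc d), ih]
    ring

end Parts

/-! ### Independence of the Newton-Cramer distribution of the base point -/

section Restrict

theorem summable_norm_sub_zpow {N : ℂ → ℤ} {d : ℕ}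
    (h : Summable fun ρ : {ρ : ℂ // ρ ≠ 0} => |(N ρ.1 : ℝ)| * ‖ρ.1‖ ^ (-(d : ℤ))) (σ : ℂ) :
    Summable fun ρ : ℂ => |(N ρ : ℝ)| * ‖ρ - σ‖ ^ (-(d : ℤ)) := by
  have hall : Summable fun ρ : ℂ => |(N ρ : ℝ)| * ‖ρ‖ ^ (-(d : ℤ)) :=
    (Set.finite_singleton (0 : ℂ)).summable_compl_iff.mp h
  set R : ℝ := 2 * ‖σ‖ + 1 with hR
  have hRpos : 0 < R := by positivity
  have hev := hall.tendsto_cofinite_zero.eventually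
    (gt_mem_nhds (show (0 : ℝ) < R ^ (-(d : ℤ)) by positivity))
  refine Summable.of_norm_bounded_eventually (hall.mul_left (2 ^ d)) ?_
  filter_upwards [hev, (Set.finite_singleton (0 : ℂ)).compl_mem_cofinite] with ρ h1 h2
  rw [Real.norm_of_nonneg (by positivity)]
  rcases eq_or_ne (N ρ) 0 with h0 | h0
  · simp [h0]
  have hρ : 0 < ‖ρ‖ := norm_pos_iff.mpr h2
  have hN : (1 : ℝ) ≤ |(N ρ : ℝ)| := by exact_mod_cast Int.one_le_abs h0
  have hle : R ≤ ‖ρ‖ := by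
    by_contra hlt
    have h3 : R ^ (-(d : ℤ)) ≤ ‖ρ‖ ^ (-(d : ℤ)) := by
      rw [zpow_neg, zpow_neg, zpow_natCast, zpow_natCast]
      exact inv_anti₀ (by positivity) (pow_le_pow_left₀ hρ.le (not_le.mp hlt).le d)
    have h4 : ‖ρ‖ ^ (-(d : ℤ)) ≤ |(N ρ : ℝ)| * ‖ρ‖ ^ (-(d : ℤ)) :=
      le_mul_of_one_le_left (by positivity) hN
    linarith
  have hsub : ‖ρ‖ / 2 ≤ ‖ρ - σ‖ := by
    have := norm_sub_norm_le ρ σ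
    linarith
  have h5 : ‖ρ - σ‖ ^ (-(d : ℤ)) ≤ 2 ^ d * ‖ρ‖ ^ (-(d : ℤ)) := by
    rw [zpow_neg, zpow_neg, zpow_natCast, zpow_natCast]
    calc (‖ρ - σ‖ ^ d)⁻¹ ≤ ((‖ρ‖ / 2) ^ d)⁻¹ :=
          inv_anti₀ (by positivity) (pow_le_pow_left₀ (by positivity) hsub d)
      _ = 2 ^ d * (‖ρ‖ ^ d)⁻¹ := by rw [div_pow, inv_div, div_eq_mul_inv]
  calc |(N ρ : ℝ)| * ‖ρ - σ‖ ^ (-(d : ℤ)) ≤ |(N ρ : ℝ)| * (2 ^ d * ‖ρ‖ ^ (-(d : ℤ))) := by gcongr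
    _ = _ := by ring

/-- The term of index `ρ` in the kernel with base point `σ`, without its multiplicity. -/
def kernelTerm (d : ℕ) (σ ρ : ℂ) (t : ℝ) : ℂ :=
  if ρ = σ then (t : ℂ) ^ d / (Nat.factorial d : ℂ)
  else Complex.exp ((ρ - σ) * (t : ℂ)) / (ρ - σ) ^ d

theorem continuous_kernelTerm (d : ℕ) (σ ρ : ℂ) : Continuous (kernelTerm d σ ρ) := by
  unfold kernelTerm
  split_ifs <;> fun_prop

theorem norm_kernelTerm_le {d : ℕ} {σ ρ : ℂ} (hne : ρ ≠ σ) {B : ℝ} (hB : (ρ - σ).re ≤ B)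
    {t : ℝ} (ht : 0 ≤ t) :
    ‖kernelTerm d σ ρ t‖ ≤ ‖ρ - σ‖ ^ (-(d : ℤ)) * Real.exp (B * t) := by
  rw [kernelTerm, if_neg hne, norm_div, Complex.norm_exp, norm_pow, zpow_neg, zpow_natCast,
    div_eq_inv_mul]
  gcongr
  simpa using mul_le_mul_of_nonneg_right hB ht

variable {f : ℂ → ℂ} {B : ℝ}

theorem norm_mult_mul_kernelTerm_le (hB : ∀ ρ, mult f ρ ≠ 0 → ρ.re ≤ B) {d : ℕ} {σ ρ : ℂ}
    (hne : ρ ≠ σ) {t : ℝ} (ht : 0 ≤ t) :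
    ‖(mult f ρ : ℂ) * kernelTerm d σ ρ t‖ ≤
      |(mult f ρ : ℝ)| * ‖ρ - σ‖ ^ (-(d : ℤ)) * Real.exp ((B - σ.re) * t) := by
  rw [norm_mul, Complex.norm_intCast]
  rcases eq_or_ne (mult f ρ) 0 with h0 | h0
  · simp [h0]
  · rw [mul_assoc]
    gcongr
    exact norm_kernelTerm_le hne (by simpa using hB ρ h0) ht

theorem hasSum_kernelK (hB : ∀ ρ, mult f ρ ≠ 0 → ρ.re ≤ B)
    (hd : Summable fun ρ : {ρ : ℂ // ρ ≠ 0} =>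
      |(mult f ρ.1 : ℝ)| * ‖ρ.1‖ ^ (-(convExponent f : ℤ))) (σ : ℂ) {t : ℝ} (ht : 0 ≤ t) :
    HasSum (fun ρ : ℂ => (mult f ρ : ℂ) * kernelTerm (convExponent f) σ ρ t)
      (kernelK f σ t) := by
  have hs : Summable fun ρ : ℂ => (mult f ρ : ℂ) * kernelTerm (convExponent f) σ ρ t := by
    refine Summable.of_norm_bounded_eventually
      ((summable_norm_sub_zpow hd σ).mul_right (Real.exp ((B - σ.re) * t))) ?_
    filter_upwards [(Set.finite_singleton σ).compl_mem_cofinite] with ρ hρ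
    exact norm_mult_mul_kernelTerm_le hB hρ ht
  have h1 := hs.tsum_subtype_add_tsum_subtype_compl {σ}
  rw [kernelK]
  convert hs.hasSum using 1
  rw [← h1]
  congr 1
  · rw [tsum_singleton σ fun ρ => (mult f ρ : ℂ) * kernelTerm (convExponent f) σ ρ t]
    simp [kernelTerm]
  · refine tsum_congr fun ρ => ?_
    have : ρ.1 ≠ σ := ρ.2
    rw [kernelTerm, if_neg this]
    ring

theorem setIntegral_Ioi_of_tsupport_subset {g ψ : ℝ → ℂ} (h : tsupport ψ ⊆ Set.Ioi 0) :
    ∫ t in Set.Ioi (0 : ℝ), g t * ψ t = ∫ t, g t * ψ t := by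
  refine setIntegral_eq_integral_of_forall_compl_eq_zero fun t ht => ?_
  rw [image_eq_zero_of_notMem_tsupport fun hmem => ht (h hmem), mul_zero]

theorem integral_kernelTerm {d : ℕ} (hd : d ≠ 0) (σ ρ : ℂ) {φ : ℝ → ℂ}
    (hs : ContDiff ℝ (⊤ : ℕ∞) φ) (hc : HasCompactSupport φ) (hsupp : tsupport φ ⊆ Set.Ioi 0) :
    (-1) ^ d * ∫ t in Set.Ioi (0 : ℝ), (kernelTerm d σ ρ t - kernelTerm d σ ρ 0) *
        iteratedDeriv d (fun u : ℝ => Complex.exp (σ * (u : ℂ)) * φ u) t =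
      ∫ t : ℝ, Complex.exp (ρ * (t : ℂ)) * φ t := by
  set ψ : ℝ → ℂ := fun u => Complex.exp (σ * (u : ℂ)) * φ u with hψ
  have h1 : ContDiff ℝ (⊤ : ℕ∞) fun u : ℝ => (u : ℂ) := Complex.ofRealCLM.contDiff
  have hψs : ContDiff ℝ (⊤ : ℕ∞) ψ := (contDiff_const.mul h1).cexp.mul hs
  have hψc : HasCompactSupport ψ := hc.mul_left
  have hψsupp : tsupport ψ ⊆ Set.Ioi 0 := (tsupport_mul_subset_right).trans hsupp
  have hcont := (contDiff_iteratedDeriv hψs d).continuous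
  have hcs := hasCompactSupport_iteratedDeriv hψc d
  rw [setIntegral_Ioi_of_tsupport_subset ((tsupport_iteratedDeriv_subset ψ d).trans hψsupp)]
  simp_rw [sub_mul]
  rw [integral_sub
    (integrable_mul_of_hasCompactSupport (continuous_kernelTerm d σ ρ) hcont hcs)
    (integrable_mul_of_hasCompactSupport continuous_const hcont hcs), integral_const_mul]
  have h0 := integral_exp_mul_iteratedDeriv 0 d hψs hψc
  simp only [zero_mul, Complex.exp_zero, one_mul, neg_zero, zero_pow hd] at h0
  rw [h0, mul_zero, sub_zero]
  have hsq : ((-1 : ℂ)) ^ d * (-1) ^ d = 1 := by rw [← mul_pow]; simp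
  by_cases hρ : ρ = σ
  · subst hρ
    simp only [kernelTerm, if_true]
    rw [integral_pow_mul_iteratedDeriv d hψs hψc, ← mul_assoc, hsq, one_mul]
  · have hne : (ρ - σ) ^ d ≠ 0 := pow_ne_zero _ (sub_ne_zero.mpr hρ)
    simp only [kernelTerm, if_neg hρ]
    simp_rw [div_mul_eq_mul_div]
    rw [integral_div, integral_exp_mul_iteratedDeriv _ d hψs hψc, neg_pow (ρ - σ), mul_assoc,
      mul_div_assoc, ← mul_assoc, hsq, one_mul, mul_div_cancel_left₀ _ hne]
    refine integral_congr_ae (Eventually.of_forall fun t => ?_)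
    simp only [hψ]
    rw [← mul_assoc, ← Complex.exp_add]
    congr 2
    ring

theorem newtonCramer_eq_of_hasSum (hB : ∀ ρ, mult f ρ ≠ 0 → ρ.re ≤ B)
    (hd : Summable fun ρ : {ρ : ℂ // ρ ≠ 0} =>
      |(mult f ρ.1 : ℝ)| * ‖ρ.1‖ ^ (-(convExponent f : ℤ)))
    (h0 : convExponent f = 0 → ∀ ρ, mult f ρ = 0) (σ : ℂ) {φ : ℝ → ℂ}
    (hs : ContDiff ℝ (⊤ : ℕ∞) φ) (hc : HasCompactSupport φ) (hsupp : tsupport φ ⊆ Set.Ioi 0)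
    {w : ℂ} (hw : HasSum (fun ρ : ℂ => (mult f ρ : ℂ) *
      ∫ t : ℝ, Complex.exp (ρ * (t : ℂ)) * φ t) w) :
    newtonCramer f σ φ = w := by
  by_cases hd0 : convExponent f = 0
  · have hz := h0 hd0
    simp only [hz, Int.cast_zero, zero_mul] at hw
    rw [hw.unique hasSum_zero, newtonCramer]
    simp [kernelK, hz]
  set d := convExponent f with hdef
  have hsum := summable_norm_sub_zpow hd σ
  set ψ : ℝ → ℂ := fun u => Complex.exp (σ * (u : ℂ)) * φ u with hψ
  have h1 : ContDiff ℝ (⊤ : ℕ∞) fun u : ℝ => (u : ℂ) := Complex.ofRealCLM.contDiff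
  have hψs : ContDiff ℝ (⊤ : ℕ∞) ψ := (contDiff_const.mul h1).cexp.mul hs
  have hψc : HasCompactSupport ψ := hc.mul_left
  have hcont := (contDiff_iteratedDeriv hψs d).continuous
  have hcs := hasCompactSupport_iteratedDeriv hψc d
  set s : Set ℂ := {ρ | mult f ρ ≠ 0} with hsdef
  have hcount : s.Countable := by
    refine Set.Countable.mono ?_ (hsum.countable_support.union (Set.countable_singleton σ))
    intro ρ hρ
    by_cases hρσ : ρ = σ
    · exact Or.inr hρσ
    · refine Or.inl (mul_ne_zero (abs_ne_zero.mpr (by exact_mod_cast hρ)) ?_)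
      exact zpow_ne_zero _ (norm_ne_zero_iff.mpr (sub_ne_zero.mpr hρσ))
  have : Countable s := hcount.to_subtype
  set F : s → ℝ → ℂ := fun ρ t => (mult f ρ : ℂ) * (kernelTerm d σ ρ t - kernelTerm d σ ρ 0) *
    iteratedDeriv d ψ t with hF
  have hFc : ∀ ρ : s, Continuous fun t : ℝ =>
      (mult f ρ : ℂ) * (kernelTerm d σ ρ t - kernelTerm d σ ρ 0) := fun ρ =>
    continuous_const.mul ((continuous_kernelTerm d σ ρ).sub continuous_const)
  have hFint : ∀ ρ : s, Integrable (F ρ) (volume.restrict (Set.Ioi 0)) := fun ρ =>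
    (integrable_mul_of_hasCompactSupport (hFc ρ) hcont hcs).integrableOn
  set G : ℝ → ℝ := fun t => (Real.exp ((B - σ.re) * t) + 1) * ‖iteratedDeriv d ψ t‖ with hG
  have hGint : Integrable G (volume.restrict (Set.Ioi 0)) := by
    refine Integrable.integrableOn ?_
    exact (Continuous.mul (by fun_prop) hcont.norm).integrable_of_hasCompactSupport
      (hcs.norm.mul_left)
  have hnorm : Summable fun ρ : s => ∫ t in Set.Ioi (0 : ℝ), ‖F ρ t‖ := by
    refine Summable.of_norm_bounded_eventually
      ((hsum.subtype s).mul_right (∫ t in Set.Ioi (0 : ℝ), G t)) ?_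
    have hfin : {ρ : s | ρ.1 = σ}.Finite :=
      Set.Subsingleton.finite fun a ha b hb => Subtype.ext (Eq.trans ha (Eq.symm hb))
    filter_upwards [hfin.compl_mem_cofinite] with ρ hρ
    have hρ' : ρ.1 ≠ σ := hρ
    rw [Real.norm_of_nonneg (integral_nonneg fun _ => norm_nonneg _), ← integral_const_mul]
    refine setIntegral_mono_on (hFint ρ).norm (hGint.const_mul _) measurableSet_Ioi fun t ht => ?_
    simp only [hF, hG, Function.comp_apply]
    rw [norm_mul, ← mul_assoc]
    gcongr
    rw [mul_sub, mul_add, mul_one]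
    refine (norm_sub_le _ _).trans (add_le_add
      (norm_mult_mul_kernelTerm_le hB hρ' (le_of_lt ht)) ?_)
    simpa using norm_mult_mul_kernelTerm_le (d := d) hB hρ' le_rfl
  have hmain := (hasSum_integral_of_summable_integral_norm hFint hnorm).mul_left ((-1 : ℂ) ^ d)
  have hpt : ∫ t in Set.Ioi (0 : ℝ), ∑' ρ : s, F ρ t =
      ∫ t in Set.Ioi (0 : ℝ), (kernelK f σ t - kernelK f σ 0) * iteratedDeriv d ψ t := by
    refine setIntegral_congr_fun measurableSet_Ioi fun t ht => HasSum.tsum_eq ?_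
    have h2 := ((hasSum_kernelK hB hd σ (le_of_lt ht)).sub
      (hasSum_kernelK hB hd σ le_rfl)).mul_right (iteratedDeriv d ψ t)
    have h3 := (hasSum_subtype_iff_of_support_subset (s := s) (fun ρ hρ h => by
      simp [h] at hρ)).mpr h2
    refine h3.congr_fun fun ρ => ?_
    simp only [hF, Function.comp_apply]
    ring
  rw [hpt] at hmain
  rw [newtonCramer, ← hdef]
  refine hmain.unique ?_
  have h4 := (hasSum_subtype_iff_of_support_subset (s := s) (fun ρ hρ h => by
      simp [h] at hρ)).mpr hw
  refine h4.congr_fun fun ρ => ?_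
  simp only [hF, Function.comp_apply]
  rw [← integral_kernelTerm hd0 σ ρ.1 hs hc hsupp]
  simp_rw [mul_assoc]
  rw [integral_const_mul]
  ring

theorem mult_eq_zero_of_summable {lam : ℝ} (hlam : 0 < lam) {P : Polynomial ℂ}
    (hmult : ∀ ρ, mult f ρ = P.rootMultiplicity (Complex.exp (lam * ρ)))
    (h : Summable fun ρ : {ρ : ℂ // ρ ≠ 0} => |(mult f ρ.1 : ℝ)| * ‖ρ.1‖ ^ (-((0 : ℕ) : ℤ)))
    (ρ : ℂ) : mult f ρ = 0 := by
  have hl : (lam : ℂ) ≠ 0 := by exact_mod_cast hlam.ne'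
  have hall := summable_norm_sub_zpow h 0
  have hinj := logBranch_injective hlam (Complex.exp (lam * ρ))
  have h2 := hall.comp_injective hinj
  have h3 : ∀ k : ℤ, mult f (logBranch lam (Complex.exp (lam * ρ)) k) = mult f ρ := by
    intro k
    rw [hmult, hmult, (exp_mul_eq_iff hlam (Complex.exp_ne_zero _) _).mpr ⟨k, rfl⟩]
  simp only [Function.comp_def, h3, Nat.cast_zero, neg_zero, zpow_zero, mul_one] at h2
  simpa using (summable_const_iff _).mp h2

theorem exists_re_le_of_mult_ne_zero {lam : ℝ} (hlam : 0 < lam) {P : Polynomial ℂ} (hP : P ≠ 0)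
    (hmult : ∀ ρ, mult f ρ = P.rootMultiplicity (Complex.exp (lam * ρ))) :
    ∃ B : ℝ, ∀ ρ, mult f ρ ≠ 0 → ρ.re ≤ B := by
  classical
  obtain ⟨C, hC⟩ := (P.roots.toFinset.image fun α => Real.log ‖α‖ / lam).bddAbove
  refine ⟨C, fun ρ hρ => ?_⟩
  have hmem : Complex.exp (lam * ρ) ∈ P.roots := by
    rw [hmult, Nat.cast_ne_zero, ← pos_iff_ne_zero, Polynomial.rootMultiplicity_pos hP] at hρ
    exact (Polynomial.mem_roots hP).mpr hρ
  refine hC (Finset.mem_coe.mpr (Finset.mem_image.mpr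
    ⟨_, Multiset.mem_toFinset.mpr hmem, ?_⟩))
  rw [Complex.norm_exp, Real.log_exp]
  simp [hlam.ne']

theorem isNewtonCramer_comb {lam : ℝ} (hlam : 0 < lam) {P : Polynomial ℂ} (hP : P ≠ 0)
    (hmult : ∀ ρ, mult f ρ = P.rootMultiplicity (Complex.exp (lam * ρ))) :
    IsNewtonCramer f (comb hlam (newtonSum P)) := by
  have hsum : ∀ φ : 𝓓(posReals, ℝ),
      HasSum (fun ρ : ℂ => (mult f ρ : ℂ) * ∫ t : ℝ, Complex.exp (ρ * (t : ℂ)) * (φ t : ℂ))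
        (comb hlam (newtonSum P) φ) := by
    intro φ
    refine (hasSum_rootMultiplicity_integral hlam P φ).congr_fun fun ρ => ?_
    rw [hmult]
    simp
  refine ⟨fun σ φ => ?_, hsum⟩
  obtain ⟨B, hB⟩ := exists_re_le_of_mult_ne_zero hlam hP hmult
  have hne : {d : ℕ | Summable fun ρ : {ρ : ℂ // ρ ≠ 0} =>
      |(mult f ρ.1 : ℝ)| * ‖ρ.1‖ ^ (-(d : ℤ))}.Nonempty := by
    refine ⟨2, ((summable_rootMultiplicity hlam P).subtype {ρ : ℂ | ρ ≠ 0}).congr fun ρ => ?_⟩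
    simp [hmult]
  have hd := Nat.sInf_mem hne
  refine (newtonCramer_eq_of_hasSum hB hd (fun h0 => mult_eq_zero_of_summable hlam hmult ?_) σ
    (contDiff_testFunction φ) (hasCompactSupport_testFunction φ) ?_ (hsum φ)).symm
  · rw [← h0]
    exact hd
  · exact (closure_mono (Function.support_comp_subset Complex.ofReal_zero φ)).trans φ.tsupport_subset

end Restrict

end PoissonNewton

end

theorem mainTheorem12 (n : ℕ) (hn : 1 ≤ n) (P : Polynomial ℂ) (hP : P.Monic)
    (hdeg : P.natDegree = n) (lam : ℝ) (hlam : 0 < lam)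
    (f : ℂ → ℂ)
    (hf : f = PoissonNewton.dirichlet (PoissonNewton.polyCoeff n P)
      (PoissonNewton.multiples n lam))
    (b : (Fin n → ℕ) → ℂ)
    (hb : b = PoissonNewton.logCoeff (PoissonNewton.polyCoeff n P)) :
    -- `f(s) = e^{-λ n s} P(e^{λ s})`
    (∀ s : ℂ, f s = Complex.exp (-(lam : ℂ) * n * s) * P.eval (Complex.exp (lam * s))) ∧
    -- the `b_k` are the coefficients of `-log f` on a right half plane
    (∃ x : ℝ, ∀ s : ℂ, x < s.re →
      HasSum (fun k : {k : Fin n → ℕ // k ≠ 0} =>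
          b k.1 * Complex.exp (-(PoissonNewton.pairing (PoissonNewton.multiples n lam) k.1 : ℂ) * s))
        (-Complex.log (f s))) ∧
    ∃ W : 𝓓'(PoissonNewton.posReals, ℂ),
      PoissonNewton.IsNewtonCramer f W ∧
      -- `W(f) = λ ∑_{m ≥ 1} S_m δ_{mλ}`
      (∀ φ : 𝓓(PoissonNewton.posReals, ℝ),
        HasSum (fun m : ℕ => (lam : ℂ) * PoissonNewton.newtonSum P (m + 1) *
          (φ (((m + 1 : ℕ) : ℝ) * lam) : ℂ)) (W φ)) ∧
      -- the equivalence, for arbitrary coefficients in place of the `b_k`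
      (∀ c : (Fin n → ℕ) → ℂ,
        PoissonNewton.Formula (PoissonNewton.multiples n lam) c W ↔
          PoissonNewton.NewtonRelations n P c) ∧
      -- both sides hold for the `b_k`
      PoissonNewton.Formula (PoissonNewton.multiples n lam) b W ∧
      PoissonNewton.NewtonRelations n P b ∧
      -- the relations in terms of the elementary symmetric functions of the roots
      (∀ m : ℕ, 1 ≤ m → PoissonNewton.newtonSum P m =
        (m : ℂ) * ∑ k ∈ PoissonNewton.weighted n m,
          (-1) ^ (m + ∑ j, k j) * (Nat.factorial ((∑ j, k j) - 1) : ℂ) /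
            ((∏ j, Nat.factorial (k j) : ℕ) : ℂ) *
            ∏ j, P.roots.esymm (j.val + 1) ^ k j) := by
  subst hf hb
  have hP0 : P ≠ 0 := hP.ne_zero
  have hfac : ∀ s : ℂ, PoissonNewton.dirichlet (PoissonNewton.polyCoeff n P)
      (PoissonNewton.multiples n lam) s =
      Complex.exp (-(lam : ℂ) * n * s) * P.eval (Complex.exp (lam * s)) := by
    intro s
    have h := PoissonNewton.one_add_sum_polyCoeff hP hdeg (Complex.exp_ne_zero (-((lam : ℂ) * s)))
    rw [← Complex.exp_neg, neg_neg, ← Complex.exp_nat_mul] at h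
    rw [PoissonNewton.dirichlet, show -(lam : ℂ) * n * s = n * -(lam * s) by ring, ← h]
    congr 1
    refine Finset.sum_congr rfl fun j _ => ?_
    rw [← Complex.exp_nat_mul, PoissonNewton.multiples]
    congr 2
    push_cast
    ring
  have hrel := PoissonNewton.newtonRelations_logCoeff hP hdeg
  refine ⟨hfac, PoissonNewton.exists_hasSum_neg_log_dirichlet _ fun j => ?_,
    PoissonNewton.comb hlam (PoissonNewton.newtonSum P),
    PoissonNewton.isNewtonCramer_comb hlam hP0
      (PoissonNewton.mult_exp_mul_eval hP0 hlam _ hfac),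
    PoissonNewton.hasSum_comb hlam _, PoissonNewton.formula_comb_iff hlam n P,
    (PoissonNewton.formula_comb_iff hlam n P _).mpr hrel, hrel, fun m hm => ?_⟩
  · unfold PoissonNewton.multiples
    positivity
  · rw [hrel m hm]
    congr 1
    exact Finset.sum_congr rfl fun k hk =>
      PoissonNewton.logCoeff_polyCoeff_eq_esymm hP hdeg hm hk
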